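/- Here $G$ denotes a finite simple graph without loops and $H$ a finite graph without multiple edges in which loops are allowed; $\hom(G,H)$ is the number of maps $\psi:V(G)\to V(H)$ such that $\psi(i)\psi(j)\in E(H)$ whenever $ij\in E(G)$. A complete looped graph is one in which any two (equal or distinct) vertices are adjacent, and a complete balanced bipartite graph is a graph $K_{k,k}$. For every integer $\delta\ge 3$ and every connected graph $H$ (possibly with loops) there exists a constant $\kappa(\delta,H)$ such that the following holds for all $n\ge\kappa(\delta,H)$ and every connected graph $G$ on $n$ vertices with minimum degree at least $\delta$: $$\hom(G,H)\le\hom(K_{\delta,n-\delta},H).$$ Further, if $H$ has at least one edge (a loop counts as an edge) and is neither a complete looped graph nor a complete balanced bipartite graph, then $\hom(G,H)=\hom(K_{\delta,n-\delta},H)$ if and only if $G$ is isomorphic to $K_{\delta,n-\delta}$. -/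

import Mathlib

/-- A graph without multiple edges in which loops are allowed: a symmetric adjacency relation on
the vertex set; `H.Adj x x` says that `x` carries a loop. -/
structure LoopGraph (W : Type*) where
  /-- The adjacency relation. -/
  Adj : W → W → Prop
  symm : ∀ x y : W, Adj x y → Adj y x

namespace LoopGraph

/-- A graph is connected if it has a vertex and any two vertices are joined by a walk. -/
def Connected {W : Type*} (H : LoopGraph W) : Prop :=
  Nonempty W ∧ ∀ x y : W, Relation.ReflTransGen H.Adj x y

/-- The complete looped graph: any two vertices, equal or distinct, are adjacent. -/
def IsCompleteLooped {W : Type*} (H : LoopGraph W) : Prop :=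
  ∀ x y : W, H.Adj x y

/-- `H` is (isomorphic to) the complete balanced bipartite graph `K_{k,k}` for some `k`. -/
def IsCompleteBalancedBipartite {W : Type*} (H : LoopGraph W) : Prop :=
  ∃ (k : ℕ) (e : W ≃ Fin k ⊕ Fin k),
    ∀ x y : W, H.Adj x y ↔ (completeBipartiteGraph (Fin k) (Fin k)).Adj (e x) (e y)

/-- `H` has at least one edge (a loop counts as an edge). -/
def HasEdge {W : Type*} (H : LoopGraph W) : Prop :=
  ∃ x y : W, H.Adj x y

/-- The `H`-colourings of a simple loopless graph `G`: the graph homomorphisms from `G` to `H`. -/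
def Colouring {V W : Type*} (G : SimpleGraph V) (H : LoopGraph W) : Type _ :=
  {f : V → W // ∀ u v : V, G.Adj u v → H.Adj (f u) (f v)}

/-- `hom(G, H)`: the number of `H`-colourings of `G` (used for finite `G` and `H`). -/
noncomputable def homCount {V W : Type*} (G : SimpleGraph V) (H : LoopGraph W) : ℕ :=
  Nat.card (Colouring G H)

end LoopGraph

/-!
Let `D` be the largest degree of `H`. A connected graph on `n` vertices can be coloured vertex by
vertex, each new vertex having a coloured neighbour, so it has at most `|W| * D ^ (n - 1)`
colourings, while `K_{δ,n-δ}` has at least `s * D ^ (n - δ)`, where `s ≥ 1` counts the colourings of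
the small class whose colours have `D` common neighbours (`card_goodTuples_mul_le`). So only a
constant factor has to be gained.

Call two adjacent uncoloured vertices, each with a coloured neighbour, an ear. Unless `H` is
complete looped or `K_{k,k}`, an ear has at most `D ^ 2 - 1` colourings, because equality with
`D ^ 2` at one place determines the neighbourhoods in all of `H` (`Connected.card_paths_lt`). Hence a
construction of `G` with a large constant number of ears leaves fewer than `D ^ (n - δ)` colourings
(`homCount_lt_of_build`).

Since degrees are at least three, breadth-first search shows that whenever two adjacent
vertices are still uncoloured, an ear can be reached after colouring only `O(log n)` further
vertices (`Build.exists_short_ear`): without a collision the layers of the search would double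
(`two_pow_le_card_layer`). So if not enough ears arise, `O(log n)` vertices meet every edge, and by
the pigeonhole principle some `δ` of them, forming a set `A`, have as many common
neighbours as desired (`exists_common_nbrs`). Colourings of `A` whose colours have fewer than `D`
common neighbours then contribute a negligible amount, and if an edge avoids `A`, a single ear over `A`
gains the factor `1 - 1 / D ^ 2` on the others (`homCount_lt_of_common_nbrs`). If no edge avoids `A`,
the degree condition makes every vertex outside `A` adjacent to all of `A`, so `G` is `K_{δ,n-δ}`
with edges possibly added inside `A`, and such an edge destroys a colouring
(`homCount_le_and_iso_of_class`). The exceptional graphs `H` are treated directly.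
-/

/-! ### Neighbourhoods in the target graph -/

namespace LoopGraph

variable {W : Type*} {H : LoopGraph W}

theorem adj_comm {x y : W} : H.Adj x y ↔ H.Adj y x := ⟨H.symm x y, H.symm y x⟩

/-- A nonempty set of vertices closed under adjacency is everything. -/
theorem Connected.mem_of_closed (hH : H.Connected) {P : W → Prop} {x : W} (hx : P x)
    (hP : ∀ y z, P y → H.Adj y z → P z) (w : W) : P w := by
  induction hH.2 x w with
  | refl => exact hx
  | tail _ h ih => exact hP _ _ ih h

/-- If any two vertices with a common neighbour were adjacent, adjacency would be transitive and
`H` would be a complete looped graph. -/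
theorem Connected.exists_common_nbr_not_adj (hH : H.Connected) (he : H.HasEdge)
    (h₁ : ¬ H.IsCompleteLooped) : ∃ x y z : W, H.Adj x z ∧ H.Adj y z ∧ ¬ H.Adj x y := by
  by_contra! hcon
  obtain ⟨a, b, hab⟩ := he
  have hnb : ∀ w, ∃ z, H.Adj w z :=
    hH.mem_of_closed (x := a) ⟨b, hab⟩ fun y z _ hyz => ⟨y, adj_comm.1 hyz⟩
  refine h₁ fun x => hH.mem_of_closed (x := x) ?_ fun y z hxy hyz => ?_
  · obtain ⟨z, hz⟩ := hnb x
    exact hcon x x z hz hz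
  · exact hcon x z y hxy (adj_comm.1 hyz)

/-- The set of neighbours of `x`; it contains `x` itself exactly when `x` carries a loop. -/
noncomputable def nbr {W : Type*} [Fintype W] (H : LoopGraph W) (x : W) : Finset W := by
  classical exact Finset.univ.filter (H.Adj x)

/-- The largest size of a neighbourhood; a loop contributes one to the degree. -/
noncomputable def maxDeg {W : Type*} [Fintype W] (H : LoopGraph W) : ℕ :=
  Finset.univ.sup fun x => (H.nbr x).card

variable [Fintype W]

@[simp]
theorem mem_nbr {x y : W} : y ∈ H.nbr x ↔ H.Adj x y := by
  classical simp [nbr]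

theorem card_nbr_le (x : W) : (H.nbr x).card ≤ H.maxDeg :=
  Finset.le_sup (f := fun x => (H.nbr x).card) (Finset.mem_univ x)

theorem exists_card_nbr_eq [Nonempty W] : ∃ x : W, (H.nbr x).card = H.maxDeg := by
  obtain ⟨x, -, hx⟩ := Finset.exists_mem_eq_sup (Finset.univ : Finset W) Finset.univ_nonempty
    fun x => (H.nbr x).card
  exact ⟨x, hx.symm⟩

theorem HasEdge.maxDeg_pos (h : H.HasEdge) : 0 < H.maxDeg := by
  obtain ⟨x, y, hxy⟩ := h
  exact (Finset.card_pos.2 ⟨y, mem_nbr.2 hxy⟩).trans_le (card_nbr_le x)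

/-- Two sets `A` and `B` of the same size that cover `W` and are completely joined make `H` a
complete looped graph (if they meet) or a complete balanced bipartite graph (if they do not). -/
theorem complete_of_nbr_eq {A B : Finset W} (hcard : A.card = B.card)
    (hA : ∀ p ∈ A, H.nbr p = B) (hB : ∀ q ∈ B, H.nbr q = A) (hcover : ∀ w, w ∈ A ∨ w ∈ B) :
    H.IsCompleteLooped ∨ H.IsCompleteBalancedBipartite := by
  classical
  by_cases hAB : Disjoint A B
  · right
    have hBA : ∀ w, w ∉ A ↔ w ∈ B := fun w =>
      ⟨fun h => (hcover w).resolve_left h, fun h h' => Finset.disjoint_left.1 hAB h' h⟩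
    let eA : {w // w ∈ A} ≃ Fin A.card := A.equivFin
    let eB : {w // w ∉ A} ≃ Fin A.card :=
      (Equiv.subtypeEquivRight hBA).trans (B.equivFin.trans (finCongr hcard.symm))
    refine ⟨A.card, (Equiv.sumCompl (· ∈ A)).symm.trans (Equiv.sumCongr eA eB), fun x y => ?_⟩
    have hadj : ∀ x y, H.Adj x y ↔ (x ∈ A ∧ y ∈ B) ∨ (x ∈ B ∧ y ∈ A) := by
      intro x y
      rw [← mem_nbr]
      rcases hcover x with hx | hx
      · have : x ∉ B := fun h => (hBA x).2 h hx
        simp [hA x hx, hx, this]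
      · have : x ∉ A := (hBA x).2 hx
        simp [hB x hx, hx, this]
    rw [hadj, ← hBA, ← hBA]
    by_cases hx : x ∈ A <;> by_cases hy : y ∈ A <;>
      simp [Equiv.sumCompl_symm_apply_of_pos, Equiv.sumCompl_symm_apply_of_neg, hx, hy]
  · left
    obtain ⟨c, hcA, hcB⟩ := Finset.not_disjoint_iff.1 hAB
    have hAB' : A = B := (hB c hcB).symm.trans (hA c hcA)
    subst hAB'
    intro x y
    rw [← mem_nbr, hA x (by simpa using hcover x)]
    simpa using hcover y

/-- Between two coloured endpoints, a path with two interior vertices has strictly fewer than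
`maxDeg ^ 2` colourings. Equality would force every neighbour of `a` to have the neighbourhood
of `b`, and this spreads to all of `H`. -/
theorem Connected.card_paths_lt (hH : H.Connected) (he : H.HasEdge) (h₁ : ¬ H.IsCompleteLooped)
    (h₂ : ¬ H.IsCompleteBalancedBipartite) (a b : W) (F : Finset (W × W))
    (hF : ∀ p ∈ F, H.Adj a p.1 ∧ H.Adj p.1 p.2 ∧ H.Adj p.2 b) :
    F.card < H.maxDeg ^ 2 := by
  classical
  by_contra! hcon
  have hpos := he.maxDeg_pos
  have hFsub : F ⊆ ((H.nbr a).sigma fun p => H.nbr p ∩ H.nbr b).image fun s => (s.1, s.2) := by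
    intro p hp
    obtain ⟨h1, h2, h3⟩ := hF p hp
    exact Finset.mem_image.2 ⟨⟨p.1, p.2⟩, by simp [h1, h2, adj_comm.1 h3], rfl⟩
  have hsum : H.maxDeg ^ 2 ≤ ∑ p ∈ H.nbr a, (H.nbr p ∩ H.nbr b).card :=
    hcon.trans <| (Finset.card_le_card hFsub).trans <|
      Finset.card_image_le.trans (Finset.card_sigma _ _).le
  have hle : ∀ p ∈ H.nbr a, (H.nbr p ∩ H.nbr b).card ≤ H.maxDeg := fun p _ =>
    (Finset.card_le_card Finset.inter_subset_left).trans (card_nbr_le p)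
  have hup : ∑ p ∈ H.nbr a, (H.nbr p ∩ H.nbr b).card ≤ (H.nbr a).card * H.maxDeg := by
    simpa using Finset.sum_le_card_nsmul _ _ _ hle
  have ha : (H.nbr a).card = H.maxDeg := by
    refine le_antisymm (card_nbr_le a) ?_
    have := hsum.trans hup
    rw [sq] at this
    exact Nat.le_of_mul_le_mul_right this hpos
  have heq : ∀ p ∈ H.nbr a, (H.nbr p ∩ H.nbr b).card = H.maxDeg := by
    refine (Finset.sum_eq_sum_iff_of_le hle).1 (le_antisymm (Finset.sum_le_sum hle) ?_)
    simpa [ha, sq] using hsum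
  have hA : ∀ p ∈ H.nbr a, H.nbr p = H.nbr b := by
    intro p hp
    have h1 : H.nbr p ∩ H.nbr b = H.nbr p :=
      Finset.eq_of_subset_of_card_le Finset.inter_subset_left
        ((card_nbr_le p).trans (heq p hp).ge)
    have h2 : H.nbr p ∩ H.nbr b = H.nbr b :=
      Finset.eq_of_subset_of_card_le Finset.inter_subset_right
        ((card_nbr_le b).trans (heq p hp).ge)
    exact h1.symm.trans h2
  obtain ⟨p, hp⟩ : (H.nbr a).Nonempty := Finset.card_pos.1 (ha ▸ hpos)
  have hb : (H.nbr b).card = H.maxDeg := by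
    rw [← heq p hp, hA p hp, Finset.inter_self]
  have hB : ∀ q ∈ H.nbr b, H.nbr q = H.nbr a := by
    intro q hq
    refine (Finset.eq_of_subset_of_card_le (fun p hp => ?_) ((card_nbr_le q).trans ha.ge)).symm
    rw [← hA p hp, mem_nbr] at hq
    exact mem_nbr.2 (adj_comm.1 hq)
  have hcover : ∀ w, w ∈ H.nbr a ∨ w ∈ H.nbr b := by
    refine hH.mem_of_closed (x := p) (Or.inl hp) ?_
    rintro y z (hy | hy) hyz
    · exact Or.inr (hA y hy ▸ mem_nbr.2 hyz)
    · exact Or.inl (hB y hy ▸ mem_nbr.2 hyz)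
  exact (complete_of_nbr_eq (ha.trans hb.symm) hA hB hcover).elim h₁ h₂

end LoopGraph

/-! ### Extending colourings along vertices and ears -/

namespace LoopGraph

/-- In a connected graph every proper nonempty set of vertices is left by an edge. -/
theorem exists_adj_of_mem_of_notMem {V : Type*} {G : SimpleGraph V} (hG : G.Connected)
    {P : V → Prop} {a b : V} (ha : P a) (hb : ¬ P b) : ∃ x y, P x ∧ ¬ P y ∧ G.Adj x y := by
  obtain ⟨p⟩ := hG.preconnected a b
  obtain ⟨d, -, h1, h2⟩ := p.exists_boundary_dart {x | P x} ha hb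
  exact ⟨d.fst, d.snd, h1, h2, d.adj⟩

variable {V : Type*} [DecidableEq V] {G : SimpleGraph V} {A S T : Finset V}

/-- `Build G A S₀ S c` says that `S` arises from `S₀` by repeatedly adding either a vertex with a
neighbour in the part `A ∪ S` reached so far, or an ear, which is an adjacent pair of vertices both
of which have a neighbour in that part; `c` counts the ears. -/
inductive Build (G : SimpleGraph V) (A S₀ : Finset V) : Finset V → ℕ → Prop
  | nil : Build G A S₀ S₀ 0
  | vertex {S c x y} : Build G A S₀ S c → x ∉ A ∪ S → y ∈ A ∪ S → G.Adj x y →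
      Build G A S₀ (insert x S) c
  | ear {S c x x' y y'} : Build G A S₀ S c → x ∉ A ∪ S → x' ∉ A ∪ S → y ∈ A ∪ S → y' ∈ A ∪ S →
      G.Adj x y → G.Adj x x' → G.Adj x' y' → Build G A S₀ (insert x (insert x' S)) (c + 1)

namespace Build

variable {S₀ : Finset V} {c : ℕ}

theorem disjoint (hA : Disjoint A S₀) (h : Build G A S₀ S c) : Disjoint A S := by
  induction h with
  | nil => exact hA
  | vertex _ hx _ _ ih =>
    simp only [Finset.mem_union, not_or] at hx
    exact Finset.disjoint_insert_right.2 ⟨hx.1, ih⟩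
  | ear _ hx hx' _ _ _ _ _ ih =>
    simp only [Finset.mem_union, not_or] at hx hx'
    exact Finset.disjoint_insert_right.2 ⟨hx.1, Finset.disjoint_insert_right.2 ⟨hx'.1, ih⟩⟩

end Build

variable [Fintype V]

/-- In a connected graph a construction sequence can be continued to all of `V`. -/
theorem Build.complete (hG : G.Connected) (hne : A.Nonempty) {S₀ S : Finset V} {c : ℕ}
    (hA : Disjoint A S₀) (h : Build G A S₀ S c) : Build G A S₀ Aᶜ c := by
  by_cases hS : ∃ b, b ∉ A ∪ S
  · obtain ⟨b, hb⟩ := hS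
    obtain ⟨a, ha⟩ := hne
    obtain ⟨y, x, hy, hx, hxy⟩ :=
      exists_adj_of_mem_of_notMem hG (P := (· ∈ A ∪ S)) (Finset.mem_union_left _ ha) hb
    have hdec : (insert x S)ᶜ.card < Sᶜ.card := by
      refine Finset.card_lt_card (Finset.compl_ssubset_compl.2 (Finset.ssubset_insert ?_))
      exact fun h => hx (Finset.mem_union_right _ h)
    exact Build.complete (S := insert x S) hG ⟨a, ha⟩ hA (h.vertex hx hy hxy.symm)
  · push Not at hS
    have : S = Aᶜ := by
      ext v
      rw [Finset.mem_compl]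
      exact ⟨fun hv hvA => Finset.disjoint_left.1 (h.disjoint hA) hvA hv,
        fun hv => (Finset.mem_union.1 (hS v)).resolve_left hv⟩
    exact this ▸ h
termination_by Sᶜ.card
decreasing_by simpa using hdec

variable {W : Type*} [Fintype W]

/-- The colourings of `A ∪ S` by `H` that extend the colouring `g` of `A`. They are encoded as maps
on all of `V` that equal `g` off `S`; the values of `g` off `A` are irrelevant. -/
noncomputable def extensions (G : SimpleGraph V) (H : LoopGraph W) (A S : Finset V) (g : V → W) :
    Finset (V → W) := by
  classical exact Finset.univ.filter fun f =>
    (∀ v, v ∉ S → f v = g v) ∧ ∀ u ∈ A ∪ S, ∀ v ∈ A ∪ S, G.Adj u v → H.Adj (f u) (f v)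

variable {H : LoopGraph W} {g f : V → W}

theorem mem_extensions : f ∈ extensions G H A S g ↔
    (∀ v, v ∉ S → f v = g v) ∧ ∀ u ∈ A ∪ S, ∀ v ∈ A ∪ S, G.Adj u v → H.Adj (f u) (f v) := by
  classical simp [extensions]

theorem card_extensions_empty_le : (extensions G H A ∅ g).card ≤ 1 := by
  refine Finset.card_le_one.2 fun f hf f' hf' => funext fun v => ?_
  rw [(mem_extensions.1 hf).1 v (by simp), (mem_extensions.1 hf').1 v (by simp)]

/-- If every extension to `A ∪ S` has at most `m` extensions to `A ∪ S ∪ T`, then the number of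
extensions grows at most by the factor `m`. -/
theorem card_extensions_union_le (hT : Disjoint T (A ∪ S)) (m : ℕ)
    (hm : ∀ f ∈ extensions G H A S g, ∀ F : Finset (V → W),
      (∀ h ∈ F, h ∈ extensions G H A (S ∪ T) g ∧ ∀ v, v ∉ T → h v = f v) → F.card ≤ m) :
    (extensions G H A (S ∪ T) g).card ≤ m * (extensions G H A S g).card := by
  classical
  refine Finset.card_le_mul_card_image_of_maps_to (f := fun h => T.piecewise g h) ?_ m ?_
  · intro h hh
    rw [mem_extensions] at hh ⊢
    refine ⟨fun v hv => ?_, fun u hu v hv huv => ?_⟩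
    · by_cases hvT : v ∈ T
      · simp [hvT]
      · simpa [hvT] using hh.1 v (by simp [hv, hvT])
    · have h1 : ∀ w ∈ A ∪ S, w ∉ T := fun w hw hwT => Finset.disjoint_left.1 hT hwT hw
      simp only [Finset.piecewise_eq_of_notMem _ _ _ (h1 u hu),
        Finset.piecewise_eq_of_notMem _ _ _ (h1 v hv)]
      have h2 : A ∪ S ⊆ A ∪ (S ∪ T) := by
        rw [← Finset.union_assoc]; exact Finset.subset_union_left
      exact hh.2 u (h2 hu) v (h2 hv) huv
  · intro f hf
    refine hm f hf _ fun h hh => ?_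
    obtain ⟨h1, rfl⟩ := Finset.mem_filter.1 hh
    exact ⟨h1, fun v hv => by simp [hv]⟩

/-- Colouring one further vertex whose colour is confined to a set `M` of at most `m` colours. -/
theorem card_extensions_insert_le {x : V} (hx : x ∉ A ∪ S) (m : ℕ)
    (hm : ∀ f ∈ extensions G H A S g, ∃ M : Finset W, M.card ≤ m ∧
      ∀ h ∈ extensions G H A (insert x S) g, (∀ v, v ≠ x → h v = f v) → h x ∈ M) :
    (extensions G H A (insert x S) g).card ≤ m * (extensions G H A S g).card := by
  have hins : insert x S = S ∪ {x} := by ext; simp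
  rw [hins] at hm ⊢
  refine card_extensions_union_le (by simpa using hx) m fun f hf F hF => ?_
  obtain ⟨M, hMm, hM⟩ := hm f hf
  refine (Finset.card_le_card_of_injOn (fun h => h x) ?_ ?_).trans hMm
  · intro h hh
    exact hM h (hF h hh).1 fun v hv => (hF h hh).2 v (by simpa using hv)
  · intro h hh h' hh' heq
    funext v
    by_cases hv : v = x
    · subst hv; exact heq
    · rw [(hF h hh).2 v (by simpa using hv), (hF h' hh').2 v (by simpa using hv)]

theorem card_extensions_vertex_le {x y : V} (hx : x ∉ A ∪ S) (hy : y ∈ A ∪ S) (hxy : G.Adj x y) :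
    (extensions G H A (insert x S) g).card ≤ H.maxDeg * (extensions G H A S g).card := by
  refine card_extensions_insert_le hx _ fun f _ => ⟨H.nbr (f y), card_nbr_le _, fun h hh hf => ?_⟩
  have hyx : y ≠ x := fun h => hx (h ▸ hy)
  rw [mem_nbr, ← hf y hyx]
  refine (mem_extensions.1 hh).2 y ?_ x (by simp) hxy.symm
  rw [Finset.union_insert]; exact Finset.mem_insert_of_mem hy

/-- Colouring two adjacent vertices, each with a coloured neighbour, loses against the trivial
bound `maxDeg ^ 2`. -/
theorem card_extensions_ear_le (hH : H.Connected) (he : H.HasEdge) (h₁ : ¬ H.IsCompleteLooped)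
    (h₂ : ¬ H.IsCompleteBalancedBipartite) {x x' y y' : V} (hx : x ∉ A ∪ S) (hx' : x' ∉ A ∪ S)
    (hy : y ∈ A ∪ S) (hy' : y' ∈ A ∪ S) (hxy : G.Adj x y) (hxx' : G.Adj x x')
    (hxy' : G.Adj x' y') :
    (extensions G H A (insert x (insert x' S)) g).card ≤
      (H.maxDeg ^ 2 - 1) * (extensions G H A S g).card := by
  classical
  have hins : insert x (insert x' S) = S ∪ {x, x'} := by
    ext v; simp only [Finset.mem_insert, Finset.mem_union, Finset.mem_singleton]; tauto
  rw [hins]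
  refine card_extensions_union_le ?_ _ fun f _ F hF => ?_
  · rw [Finset.disjoint_left]; simp only [Finset.mem_insert, Finset.mem_singleton]
    rintro v (rfl | rfl) <;> assumption
  have hsub : A ∪ S ⊆ A ∪ (S ∪ {x, x'}) := by
    rw [← Finset.union_assoc]; exact Finset.subset_union_left
  have hf : ∀ h ∈ F, ∀ v ∈ A ∪ S, h v = f v := by
    intro h hh v hv
    refine (hF h hh).2 v ?_
    simp only [Finset.mem_insert, Finset.mem_singleton]
    rintro (rfl | rfl) <;> contradiction
  have hlt := hH.card_paths_lt he h₁ h₂ (f y) (f y') (F.image fun h => (h x, h x')) ?_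
  · rw [Finset.card_image_of_injOn] at hlt
    · omega
    · intro h hh h' hh' heq
      simp only [Prod.mk.injEq] at heq
      funext v
      by_cases hv : v ∈ ({x, x'} : Finset V)
      · simp only [Finset.mem_insert, Finset.mem_singleton] at hv
        rcases hv with rfl | rfl
        exacts [heq.1, heq.2]
      · rw [(hF h hh).2 v hv, (hF h' hh').2 v hv]
  · intro p hp
    obtain ⟨h, hh, rfl⟩ := Finset.mem_image.1 hp
    have hadj := (mem_extensions.1 (hF h hh).1).2
    rw [← hf h hh y hy, ← hf h hh y' hy']
    exact ⟨hadj y (hsub hy) x (by simp) hxy.symm, hadj x (by simp) x' (by simp) hxx',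
      hadj x' (by simp) y' (hsub hy') hxy'⟩

/-- Common neighbours of `A` have few colours when the colours of `A` have few common
neighbours. -/
theorem card_extensions_common_nbr_le {m : ℕ} {M : Finset W} (hM : M.card ≤ m)
    (hgM : ∀ w, (∀ a ∈ A, H.Adj (g a) w) → w ∈ M) (hT : Disjoint T A)
    (hTA : ∀ x ∈ T, ∀ a ∈ A, G.Adj a x) :
    (extensions G H A T g).card ≤ m ^ T.card := by
  induction T using Finset.induction_on with
  | empty => simpa using card_extensions_empty_le
  | insert x T hxT ih =>
    rw [Finset.disjoint_insert_left] at hT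
    rw [Finset.card_insert_of_notMem hxT, pow_succ']
    refine (card_extensions_insert_le (by simp [hT.1, hxT]) m fun f _ =>
      ⟨M, hM, fun h hh _ => hgM _ fun a ha => ?_⟩).trans
      (Nat.mul_le_mul_left m (ih hT.2 fun y hy => hTA y (Finset.mem_insert_of_mem hy)))
    have haT : a ∉ insert x T := by
      simp only [Finset.mem_insert, not_or]
      exact ⟨fun h => hT.1 (h ▸ ha), fun h => Finset.disjoint_left.1 hT.2 h ha⟩
    rw [mem_extensions] at hh
    rw [← hh.1 a haT]
    exact hh.2 a (by simp [ha]) x (by simp) (hTA x (by simp) a ha)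

namespace Build

variable {S₀ : Finset V} {c : ℕ}

/-- Each vertex costs a factor at most `maxDeg`, without any assumption on `H`. -/
theorem card_extensions_le (h : Build G A S₀ S c) (g : V → W) :
    (extensions G H A S g).card * H.maxDeg ^ S₀.card ≤
      (extensions G H A S₀ g).card * H.maxDeg ^ S.card := by
  have step : ∀ {S : Finset V} {x y : V}, x ∉ A ∪ S → y ∈ A ∪ S → G.Adj x y →
      (extensions G H A S g).card * H.maxDeg ^ S₀.card ≤
        (extensions G H A S₀ g).card * H.maxDeg ^ S.card →
      (extensions G H A (insert x S) g).card * H.maxDeg ^ S₀.card ≤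
        (extensions G H A S₀ g).card * H.maxDeg ^ (insert x S).card := by
    intro S x y hx hy hxy ih
    have hxS : x ∉ S := fun h => hx (Finset.mem_union_right _ h)
    rw [Finset.card_insert_of_notMem hxS, pow_succ]
    calc _ ≤ H.maxDeg * (extensions G H A S g).card * H.maxDeg ^ S₀.card :=
          Nat.mul_le_mul_right _ (card_extensions_vertex_le hx hy hxy)
      _ = H.maxDeg * ((extensions G H A S g).card * H.maxDeg ^ S₀.card) := by ring
      _ ≤ H.maxDeg * ((extensions G H A S₀ g).card * H.maxDeg ^ S.card) :=
          Nat.mul_le_mul_left _ ih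
      _ = _ := by ring
  induction h with
  | nil => exact le_rfl
  | vertex _ hx hy hxy ih => exact step hx hy hxy ih
  | @ear S c x x' y y' _ hx hx' hy hy' hxy hxx' hxy' ih =>
    refine step (y := y) ?_ ?_ hxy (step hx' hy' hxy' ih)
    · rw [Finset.union_insert, Finset.mem_insert, not_or]
      exact ⟨hxx'.ne, hx⟩
    · rw [Finset.union_insert]; exact Finset.mem_insert_of_mem hy

/-- Each ear costs a factor at most `maxDeg ^ 2 - 1` instead of `maxDeg ^ 2`. -/
theorem card_extensions_mul_le (hH : H.Connected) (he : H.HasEdge) (h₁ : ¬ H.IsCompleteLooped)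
    (h₂ : ¬ H.IsCompleteBalancedBipartite) (h : Build G A ∅ S c) (g : V → W) :
    (extensions G H A S g).card * (H.maxDeg ^ 2) ^ c ≤
      H.maxDeg ^ S.card * (H.maxDeg ^ 2 - 1) ^ c := by
  induction h with
  | nil => simpa using card_extensions_empty_le
  | @vertex S c x y _ hx hy hxy ih =>
    have hxS : x ∉ S := fun h => hx (Finset.mem_union_right _ h)
    rw [Finset.card_insert_of_notMem hxS]
    calc _ ≤ H.maxDeg * (extensions G H A S g).card * (H.maxDeg ^ 2) ^ c :=
          Nat.mul_le_mul_right _ (card_extensions_vertex_le hx hy hxy)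
      _ = H.maxDeg * ((extensions G H A S g).card * (H.maxDeg ^ 2) ^ c) := by ring
      _ ≤ H.maxDeg * (H.maxDeg ^ S.card * (H.maxDeg ^ 2 - 1) ^ c) := Nat.mul_le_mul_left _ ih
      _ = _ := by ring
  | @ear S c x x' y y' _ hx hx' hy hy' hxy hxx' hxy' ih =>
    have hxS : x ∉ S := fun h => hx (Finset.mem_union_right _ h)
    have hxS' : x' ∉ S := fun h => hx' (Finset.mem_union_right _ h)
    rw [Finset.card_insert_of_notMem (by simp [hxx'.ne, hxS]), Finset.card_insert_of_notMem hxS']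
    calc _ ≤ (H.maxDeg ^ 2 - 1) * (extensions G H A S g).card * (H.maxDeg ^ 2) ^ (c + 1) :=
          Nat.mul_le_mul_right _
            (card_extensions_ear_le hH he h₁ h₂ hx hx' hy hy' hxy hxx' hxy')
      _ = (H.maxDeg ^ 2 - 1) * H.maxDeg ^ 2 *
            ((extensions G H A S g).card * (H.maxDeg ^ 2) ^ c) := by ring
      _ ≤ (H.maxDeg ^ 2 - 1) * H.maxDeg ^ 2 * (H.maxDeg ^ S.card * (H.maxDeg ^ 2 - 1) ^ c) :=
          Nat.mul_le_mul_left _ ih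
      _ = _ := by ring

end Build

end LoopGraph

/-! ### Finding short ears -/

namespace LoopGraph

variable {V : Type*} [DecidableEq V] {G : SimpleGraph V} {A S T : Finset V}

/-- If `u ∈ T` can be reached from the part `A ∪ S`, has a neighbour in `T`, and every other vertex
of `T` has two neighbours in `A ∪ S ∪ T`, then an ear can be gained inside `T`. A path in `T` is
followed from `u` until it meets a neighbour of the part reached so far. -/
theorem Build.exists_ear {S₀ S T : Finset V} {c : ℕ} {u r w : V} (h : Build G A S₀ S c)
    (hT : Disjoint T (A ∪ S)) (hu : u ∈ T) (hr : r ∈ A ∪ S) (hur : G.Adj u r) (hw : w ∈ T)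
    (huw : G.Adj u w)
    (hdeg : ∀ x ∈ T, x ≠ u →
      ∃ y ∈ A ∪ S ∪ T, ∃ z ∈ A ∪ S ∪ T, y ≠ z ∧ G.Adj x y ∧ G.Adj x z) :
    ∃ S' ⊆ S ∪ T, Build G A S₀ S' (c + 1) := by
  have hu' := Finset.disjoint_left.1 hT hu
  have hw' := Finset.disjoint_left.1 hT hw
  by_cases hwr : ∃ r' ∈ A ∪ S, G.Adj w r'
  · obtain ⟨r', hr', hwr'⟩ := hwr
    refine ⟨_, ?_, h.ear hu' hw' hr hr' hur huw hwr'⟩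
    intro v hv
    simp only [Finset.mem_insert] at hv
    rcases hv with rfl | rfl | hv
    exacts [Finset.mem_union_right _ hu, Finset.mem_union_right _ hw, Finset.mem_union_left _ hv]
  · push Not at hwr
    obtain ⟨z, hz, hzu, hwz⟩ : ∃ z ∈ T, z ≠ u ∧ G.Adj w z := by
      obtain ⟨y, hy, z, hz, hyz, hwy, hwz⟩ := hdeg w hw huw.ne'
      have hyT : y ∈ T := (Finset.mem_union.1 hy).resolve_left fun h => hwr y h hwy
      have hzT : z ∈ T := (Finset.mem_union.1 hz).resolve_left fun h => hwr z h hwz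
      by_cases hyu : y = u
      · exact ⟨z, hzT, fun h => hyz (hyu.trans h.symm), hwz⟩
      · exact ⟨y, hyT, hyu, hwy⟩
    have hAS : A ∪ insert u S ∪ T.erase u = A ∪ S ∪ T := by
      ext v
      by_cases hv : v = u
      · subst hv; simp [hu]
      · simp [hv]
    have hcard : (T.erase u).card < T.card := Finset.card_erase_lt_of_mem hu
    have hT' : Disjoint (T.erase u) (A ∪ insert u S) := by
      rw [Finset.disjoint_left] at hT ⊢
      intro v hv hv'
      rw [Finset.union_insert, Finset.mem_insert] at hv'
      exact hv'.elim (Finset.mem_erase.1 hv).1 (hT (Finset.mem_erase.1 hv).2)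
    obtain ⟨S', hS', hb⟩ := Build.exists_ear (u := w) (r := u) (w := z) (h.vertex hu' hr hur) hT'
      (Finset.mem_erase.2 ⟨huw.ne', hw⟩) (by simp) huw.symm (Finset.mem_erase.2 ⟨hzu, hz⟩) hwz
      fun x hx _ => by
        rw [hAS]
        exact hdeg x (Finset.mem_erase.1 hx).2 (Finset.mem_erase.1 hx).1
    refine ⟨S', hS'.trans ?_, hb⟩
    intro v hv
    simp only [Finset.mem_union, Finset.mem_insert, Finset.mem_erase] at hv ⊢
    rcases hv with (rfl | hv) | hv
    exacts [Or.inr hu, Or.inl hv, Or.inr hv.2]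
termination_by T.card

/-- If some edge avoids the nonempty set `R`, then some edge avoiding `R` has an end with a neighbour
in `R`. -/
theorem exists_adj_boundary (hG : G.Connected) {R : Finset V} (hR : R.Nonempty) {x x' : V}
    (hx : x ∉ R) (hx' : x' ∉ R) (hxx' : G.Adj x x') :
    ∃ u w r, u ∉ R ∧ w ∉ R ∧ r ∈ R ∧ G.Adj u w ∧ G.Adj u r := by
  obtain ⟨a, ha⟩ := hR
  obtain ⟨u, p, ⟨hu, w, hw, huw⟩, hp, hup⟩ := exists_adj_of_mem_of_notMem hG
    (P := fun q => q ∉ R ∧ ∃ w, w ∉ R ∧ G.Adj q w) (a := x) (b := a) ⟨hx, x', hx', hxx'⟩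
    (fun h => h.1 ha)
  refine ⟨u, w, p, hu, hw, ?_, huw, hup⟩
  by_contra hpR
  exact hp ⟨hpR, u, hu, hup.symm⟩

variable [Fintype V] [DecidableRel G.Adj]

/-- As long as some edge avoids the part reached so far, an ear can be gained. -/
theorem Build.exists_ear_of_adj (hG : G.Connected) (hne : A.Nonempty) {S₀ : Finset V} {c : ℕ}
    (h : Build G A S₀ S c) (hdeg : ∀ v, 2 ≤ G.degree v) {x x' : V} (hx : x ∉ A ∪ S)
    (hx' : x' ∉ A ∪ S) (hxx' : G.Adj x x') : ∃ S', Build G A S₀ S' (c + 1) := by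
  obtain ⟨u, w, r, hu, hw, hr, huw, hur⟩ := exists_adj_boundary hG
    (hne.mono Finset.subset_union_left) hx hx' hxx'
  obtain ⟨S', -, hS'⟩ := h.exists_ear (T := (A ∪ S)ᶜ) (u := u) (w := w) (r := r)
    disjoint_compl_left (by simpa using hu) hr hur (by simpa using hw) huw fun x _ _ => by
      obtain ⟨y, hy, z, hz, hyz⟩ := Finset.one_lt_card.1
        ((hdeg x).trans_eq (G.card_neighborFinset_eq_degree x).symm)
      rw [SimpleGraph.mem_neighborFinset] at hy hz
      exact ⟨y, by rw [Finset.union_compl]; simp, z, by rw [Finset.union_compl]; simp, hyz, hy, hz⟩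
  exact ⟨S', hS'⟩

/-- The ball of radius `j` about `u` in the graph obtained by deleting `R`. -/
def ball (G : SimpleGraph V) [DecidableRel G.Adj] (R : Finset V) (u : V) : ℕ → Finset V
  | 0 => {u}
  | j + 1 => ball G R u j ∪ Finset.univ.filter fun x => x ∉ R ∧ ∃ y ∈ ball G R u j, G.Adj x y

variable {R : Finset V} {u : V}

theorem mem_ball_succ {j : ℕ} {x : V} : x ∈ ball G R u (j + 1) ↔
    x ∈ ball G R u j ∨ x ∉ R ∧ ∃ y ∈ ball G R u j, G.Adj x y := by
  simp [ball]

theorem ball_subset_succ (j : ℕ) : ball G R u j ⊆ ball G R u (j + 1) := fun _ h =>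
  mem_ball_succ.2 (Or.inl h)

theorem mem_ball_self (j : ℕ) : u ∈ ball G R u j := by
  induction j with
  | zero => simp [ball]
  | succ j ih => exact ball_subset_succ j ih

theorem disjoint_ball (hu : u ∉ R) (j : ℕ) : Disjoint (ball G R u j) R := by
  rw [Finset.disjoint_left]
  induction j with
  | zero => simpa [ball] using hu
  | succ j ih =>
    intro x hx
    exact (mem_ball_succ.1 hx).elim (ih ·) (·.1)

/-- A vertex `x` of the ball of radius `j` lies with `u` in a set of at most `j + 1` vertices (the
vertices of a path from `u` to `x`) in which every vertex other than `u` and `x` has two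
neighbours. -/
theorem exists_path_set (j : ℕ) (x : V) (hx : x ∈ ball G R u j) :
    ∃ P ⊆ insert x (ball G R u (j - 1)), P.card ≤ j + 1 ∧ u ∈ P ∧ x ∈ P ∧
      (∀ y ∈ P, y ≠ u → y ≠ x → ∃ a ∈ P, ∃ b ∈ P, a ≠ b ∧ G.Adj y a ∧ G.Adj y b) ∧
      (x ≠ u → ∃ z ∈ P, G.Adj x z) ∧ (x ≠ u → ∃ z ∈ P, G.Adj u z) := by
  induction j generalizing x with
  | zero =>
    obtain rfl : x = u := by simpa [ball] using hx
    exact ⟨{x}, by simp, by simp, by simp, by simp,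
      fun y hy h => absurd (Finset.mem_singleton.1 hy) h, by simp, by simp⟩
  | succ j ih =>
    have hmono : ball G R u (j - 1) ⊆ ball G R u j := by
      cases j with
      | zero => exact Finset.Subset.refl _
      | succ j => exact ball_subset_succ j
    rw [Nat.add_sub_cancel]
    by_cases hxj : x ∈ ball G R u j
    · obtain ⟨P, hP, hc, h⟩ := ih x hxj
      exact ⟨P, hP.trans (Finset.insert_subset_insert _ hmono), by omega, h⟩
    · obtain ⟨-, y, hy, hxy⟩ := (mem_ball_succ.1 hx).resolve_left hxj
      obtain ⟨P, hP, hc, hu, hyP, h2, hy1, hu1⟩ := ih y hy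
      have hPj : P ⊆ ball G R u j :=
        hP.trans (Finset.insert_subset hy hmono)
      have hxP : x ∉ P := fun h => hxj (hPj h)
      refine ⟨insert x P, Finset.insert_subset_insert _ hPj, ?_, by simp [hu], by simp, ?_, ?_, ?_⟩
      · rw [Finset.card_insert_of_notMem hxP]; omega
      · intro v hv hvu hvx
        have hvP : v ∈ P := (Finset.mem_insert.1 hv).resolve_left hvx
        by_cases hvy : v = y
        · subst hvy
          obtain ⟨z, hz, hvz⟩ := hy1 hvu
          exact ⟨z, by simp [hz], x, by simp, fun h => hxP (h ▸ hz), hvz, hxy.symm⟩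
        · obtain ⟨a, ha, b, hb, h⟩ := h2 v hvP hvu hvy
          exact ⟨a, by simp [ha], b, by simp [hb], h⟩
      · exact fun _ => ⟨y, by simp [hyP], hxy⟩
      · intro _
        by_cases hyu : y = u
        · subst hyu; exact ⟨x, by simp, hxy.symm⟩
        · obtain ⟨z, hz, h⟩ := hu1 hyu
          exact ⟨z, by simp [hz], h⟩

/-- `T` is a set, disjoint from `R` and containing `u`, to which the gain of an ear applies: `u` has
a neighbour in `T`, and the other vertices of `T` have two neighbours in `R ∪ T`. -/
def IsEarSet (G : SimpleGraph V) (R : Finset V) (u : V) (T : Finset V) : Prop :=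
  Disjoint T R ∧ u ∈ T ∧ (∃ w ∈ T, G.Adj u w) ∧
    ∀ x ∈ T, x ≠ u → ∃ y ∈ R ∪ T, ∃ z ∈ R ∪ T, y ≠ z ∧ G.Adj x y ∧ G.Adj x z

/-- A vertex in layer `j + 1` with a neighbour in `R`, or with a second neighbour in the ball of
radius `j + 1`, yields a small ear set: the union of the paths to its two neighbours. -/
theorem exists_isEarSet_of_collision (hu : u ∉ R) {j : ℕ} {x a b : V}
    (hx : x ∈ ball G R u (j + 1)) (hxj : x ∉ ball G R u j) (hb : b ∈ ball G R u j)
    (hxb : G.Adj x b) (hxa : G.Adj x a) (hab : a ≠ b) (ha : a ∈ R ∨ a ∈ ball G R u (j + 1)) :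
    ∃ T, IsEarSet G R u T ∧ T.card ≤ 2 * j + 4 := by
  have hxR : x ∉ R := Finset.disjoint_left.1 (disjoint_ball hu _) hx
  have hmono : ball G R u (j - 1) ⊆ ball G R u j := by
    cases j with
    | zero => exact Finset.Subset.refl _
    | succ j => exact ball_subset_succ j
  obtain ⟨P, hP, hPc, huP, hbP, hP2, hP1, hPu⟩ := exists_path_set j b hb
  have hPj : P ⊆ ball G R u j := hP.trans (Finset.insert_subset hb hmono)
  have hxP : x ∉ P := fun h => hxj (hPj h)
  have hPR : Disjoint P R := (disjoint_ball hu j).mono_left hPj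
  have hbcase : ∀ {Q : Finset V}, P ⊆ Q → x ∈ Q → ∀ y ∈ P, y ≠ u →
      ∃ y₁ ∈ R ∪ Q, ∃ y₂ ∈ R ∪ Q, y₁ ≠ y₂ ∧ G.Adj y y₁ ∧ G.Adj y y₂ := by
    intro Q hPQ hxQ y hy hyu
    by_cases hyb : y = b
    · subst hyb
      obtain ⟨z, hz, hyz⟩ := hP1 hyu
      exact ⟨z, Finset.mem_union_right _ (hPQ hz), x, Finset.mem_union_right _ hxQ,
        fun h => hxP (h ▸ hz), hyz, hxb.symm⟩
    · obtain ⟨y₁, h1, y₂, h2, h⟩ := hP2 y hy hyu hyb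
      exact ⟨y₁, Finset.mem_union_right _ (hPQ h1), y₂, Finset.mem_union_right _ (hPQ h2), h⟩
  have hunb : ∃ w ∈ insert x P, G.Adj u w := by
    by_cases hbu : b = u
    · subst hbu; exact ⟨x, by simp, hxb.symm⟩
    · obtain ⟨z, hz, h⟩ := hPu hbu
      exact ⟨z, by simp [hz], h⟩
  rcases ha with ha | ha
  · refine ⟨insert x P, ⟨?_, by simp [huP], hunb, ?_⟩, ?_⟩
    · exact Finset.disjoint_insert_left.2 ⟨hxR, hPR⟩
    · intro y hy hyu
      rcases Finset.mem_insert.1 hy with rfl | hy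
      · exact ⟨a, by simp [ha], b, by simp [hbP], hab, hxa, hxb⟩
      · exact hbcase (Finset.subset_insert _ _) (by simp) y hy hyu
    · exact (Finset.card_insert_le _ _).trans (by omega)
  · obtain ⟨Q, hQ, hQc, huQ, haQ, hQ2, hQ1, hQu⟩ := exists_path_set (j + 1) a ha
    rw [Nat.add_sub_cancel] at hQ
    have hxQ : x ∉ Q := fun h => (Finset.mem_insert.1 (hQ h)).elim (fun h => hxa.ne h) hxj
    have hQR : Disjoint Q R := (disjoint_ball hu (j + 1)).mono_left
      (hQ.trans (Finset.insert_subset ha (ball_subset_succ j)))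
    refine ⟨insert x (P ∪ Q), ⟨?_, by simp [huP], ?_, ?_⟩, ?_⟩
    · exact Finset.disjoint_insert_left.2 ⟨hxR, Finset.disjoint_union_left.2 ⟨hPR, hQR⟩⟩
    · obtain ⟨w, hw, h⟩ := hunb
      exact ⟨w, Finset.insert_subset_insert _ Finset.subset_union_left hw, h⟩
    · intro y hy hyu
      rw [Finset.mem_insert, Finset.mem_union] at hy
      rcases hy with rfl | hy | hy
      · exact ⟨a, by simp [haQ], b, by simp [hbP], hab, hxa, hxb⟩
      · exact hbcase (fun v hv => by simp [hv]) (by simp) y hy hyu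
      · by_cases hya : y = a
        · subst hya
          obtain ⟨z, hz, hyz⟩ := hQ1 hyu
          exact ⟨z, by simp [hz], x, by simp, fun h => hxQ (h ▸ hz), hyz, hxa.symm⟩
        · obtain ⟨y₁, h1, y₂, h2, h⟩ := hQ2 y hy hyu hya
          exact ⟨y₁, by simp [h1], y₂, by simp [h2], h⟩
    · have h1 := Finset.card_insert_le x (P ∪ Q)
      have h2 := Finset.card_union_le P Q
      omega

/-- Without small ear sets, the layers of the balls about `u` double in size. -/
theorem two_pow_le_card_layer (hdeg : ∀ v, 3 ≤ G.degree v) (hu : u ∉ R) {w : V} (hw : w ∉ R)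
    (huw : G.Adj u w) {m : ℕ} (hm : ∀ T, IsEarSet G R u T → 2 * m + 4 < T.card) (j : ℕ)
    (hj : j ≤ m) : 2 ^ j ≤ (ball G R u (j + 1) \ ball G R u j).card := by
  induction j with
  | zero =>
    refine Finset.card_pos.2 ⟨w, Finset.mem_sdiff.2 ⟨mem_ball_succ.2 (Or.inr ⟨hw, u, ?_, huw.symm⟩),
      ?_⟩⟩
    · exact mem_ball_self 0
    · simpa [ball] using huw.ne'
  | succ j ih =>
    -- A vertex of layer `i + 1` has a single neighbour in `R` and the ball of radius `i + 1`.
    have huniq : ∀ i ≤ m, ∀ x ∈ ball G R u (i + 1) \ ball G R u i,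
        ∃ b, ∀ a, G.Adj x a → a ∈ R ∪ ball G R u (i + 1) → a = b := by
      intro i hi x hx
      obtain ⟨hx, hxi⟩ := Finset.mem_sdiff.1 hx
      obtain ⟨-, b, hb, hxb⟩ := (mem_ball_succ.1 hx).resolve_left hxi
      refine ⟨b, fun a hxa ha => ?_⟩
      by_contra hab
      obtain ⟨T, hT, hTc⟩ := exists_isEarSet_of_collision hu hx hxi hb hxb hxa hab
        (Finset.mem_union.1 ha)
      have := hm T hT
      omega
    have hcount := Finset.card_mul_le_card_mul (s := ball G R u (j + 1) \ ball G R u j)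
      (t := ball G R u (j + 2) \ ball G R u (j + 1)) (m := 2) (n := 1) G.Adj ?_ ?_
    · calc 2 ^ (j + 1) = 2 ^ j * 2 := pow_succ _ _
        _ ≤ _ := Nat.mul_le_mul_right 2 (ih (by omega))
        _ ≤ _ := hcount.trans (Nat.mul_one _).le
    · intro x hx
      obtain ⟨b, hb⟩ := huniq j (by omega) x hx
      have hsub : (G.neighborFinset x).erase b ⊆
          Finset.bipartiteAbove G.Adj (ball G R u (j + 2) \ ball G R u (j + 1)) x := by
        intro a ha
        obtain ⟨hab, hxa⟩ := Finset.mem_erase.1 ha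
        rw [SimpleGraph.mem_neighborFinset] at hxa
        have haR : a ∉ R ∪ ball G R u (j + 1) := fun h => hab (hb a hxa h)
        rw [Finset.mem_union, not_or] at haR
        exact (Finset.mem_bipartiteAbove _).2 ⟨Finset.mem_sdiff.2 ⟨mem_ball_succ.2
          (Or.inr ⟨haR.1, x, (Finset.mem_sdiff.1 hx).1, hxa.symm⟩), haR.2⟩, hxa⟩
      have h1 := Finset.card_le_card hsub
      have h2 := Finset.pred_card_le_card_erase (s := G.neighborFinset x) (a := b)
      have h3 := hdeg x
      rw [← G.card_neighborFinset_eq_degree x] at h3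
      omega
    · intro y hy
      obtain ⟨b, hb⟩ := huniq (j + 1) hj y hy
      refine Finset.card_le_one.2 fun x hx x' hx' => ?_
      rw [Finset.mem_bipartiteBelow] at hx hx'
      have key : ∀ x ∈ ball G R u (j + 1) \ ball G R u j, x ∈ R ∪ ball G R u (j + 2) :=
        fun x hx => Finset.mem_union_right _ (ball_subset_succ _ (Finset.mem_sdiff.1 hx).1)
      rw [hb x hx.2.symm (key x hx.1), hb x' hx'.2.symm (key x' hx'.1)]

/-- In a graph of minimum degree at least three there is an ear set of logarithmic size. -/
theorem exists_isEarSet (hdeg : ∀ v, 3 ≤ G.degree v) (hu : u ∉ R) {w : V} (hw : w ∉ R)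
    (huw : G.Adj u w) :
    ∃ T, IsEarSet G R u T ∧ T.card ≤ 2 * Nat.log 2 (Fintype.card V) + 6 := by
  by_contra! hcon
  have h1 := two_pow_le_card_layer hdeg hu hw huw (m := Nat.log 2 (Fintype.card V) + 1)
    (fun T hT => by have := hcon T hT; omega) _ le_rfl
  have h2 := h1.trans (Finset.card_le_univ _)
  have h3 := Nat.lt_pow_succ_log_self (b := 2) one_lt_two (Fintype.card V)
  exact absurd h2 (not_le.2 h3)

/-- As long as some edge avoids the part reached so far, an ear can be gained at the cost of
logarithmically many new vertices. -/
theorem Build.exists_short_ear (hG : G.Connected) (hne : A.Nonempty) {S₀ : Finset V} {c : ℕ}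
    (h : Build G A S₀ S c) (hdeg : ∀ v, 3 ≤ G.degree v) {x x' : V} (hx : x ∉ A ∪ S)
    (hx' : x' ∉ A ∪ S) (hxx' : G.Adj x x') :
    ∃ S', Build G A S₀ S' (c + 1) ∧
      S'.card ≤ S.card + (2 * Nat.log 2 (Fintype.card V) + 6) := by
  obtain ⟨u, w, r, hu, hw, hr, huw, hur⟩ := exists_adj_boundary hG
    (hne.mono Finset.subset_union_left) hx hx' hxx'
  obtain ⟨T, ⟨hTR, huT, ⟨v, hv, huv⟩, hT⟩, hTc⟩ := exists_isEarSet hdeg hu hw huw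
  obtain ⟨S', hS', hb⟩ := h.exists_ear hTR huT hr hur hv huv hT
  exact ⟨S', hb, (Finset.card_le_card hS').trans ((Finset.card_union_le _ _).trans (by omega))⟩

/-- Either `c` ears can be gained, or `O(log n)` vertices together with `A` meet every edge. -/
theorem exists_build_or_cover (hG : G.Connected) (hne : A.Nonempty)
    (hdeg : ∀ v, 3 ≤ G.degree v) (c : ℕ) :
    (∃ S, Build G A ∅ S c ∧ S.card ≤ c * (2 * Nat.log 2 (Fintype.card V) + 6)) ∨
      ∃ S : Finset V, S.card ≤ c * (2 * Nat.log 2 (Fintype.card V) + 6) ∧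
        ∀ x x', G.Adj x x' → x ∈ A ∪ S ∨ x' ∈ A ∪ S := by
  induction c with
  | zero => exact Or.inl ⟨∅, .nil, by simp⟩
  | succ c ih =>
    have hstep : c * (2 * Nat.log 2 (Fintype.card V) + 6) +
        (2 * Nat.log 2 (Fintype.card V) + 6) =
        (c + 1) * (2 * Nat.log 2 (Fintype.card V) + 6) := by ring
    rcases ih with ⟨S, hS, hSc⟩ | ⟨S, hSc, hS⟩
    · by_cases hcov : ∀ x x', G.Adj x x' → x ∈ A ∪ S ∨ x' ∈ A ∪ S
      · exact Or.inr ⟨S, by omega, hcov⟩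
      · push Not at hcov
        obtain ⟨x, x', hxx', hx, hx'⟩ := hcov
        obtain ⟨S', hS', hc⟩ := hS.exists_short_ear hG hne hdeg hx hx' hxx'
        exact Or.inl ⟨S', hS', by omega⟩
    · exact Or.inr ⟨S, by omega, hS⟩

end LoopGraph

/-! ### Counting colourings -/

namespace LoopGraph

section Basic

variable {V V' W : Type*} {G : SimpleGraph V} {G' : SimpleGraph V'} {H : LoopGraph W}

theorem homCount_congr (e : G ≃g G') : homCount G H = homCount G' H := by
  refine Nat.card_congr ⟨fun f => ⟨f.1 ∘ e.symm, fun u v h => f.2 _ _ ?_⟩,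
    fun f => ⟨f.1 ∘ e, fun u v h => f.2 _ _ ?_⟩, fun f => ?_, fun f => ?_⟩
  · exact e.symm.map_adj_iff.2 h
  · exact e.map_adj_iff.2 h
  · exact Subtype.ext (funext fun v => by simp)
  · exact Subtype.ext (funext fun v => by simp)

/-- Complete bipartite graphs on classes of equal sizes are isomorphic. -/
def completeBipartiteIso {α β α' β' : Type*} (e : α ≃ α') (f : β ≃ β') :
    completeBipartiteGraph α β ≃g completeBipartiteGraph α' β' :=
  ⟨Equiv.sumCongr e f, by rintro (_ | _) (_ | _) <;> simp⟩

theorem homCount_eq_zero (hV : ∃ u v, G.Adj u v) (he : ¬ H.HasEdge) : homCount G H = 0 := by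
  obtain ⟨u, v, huv⟩ := hV
  have : IsEmpty (Colouring G H) := ⟨fun f => he ⟨_, _, f.2 u v huv⟩⟩
  exact Nat.card_of_isEmpty

end Basic

section Count

variable {W : Type*} [Fintype W] {H : LoopGraph W}

/-- The colours adjacent to all the colours `g i`. -/
noncomputable def commonNbr {ι : Type*} (H : LoopGraph W) (g : ι → W) : Finset W := by
  classical exact Finset.univ.filter fun w => ∀ i, H.Adj (g i) w

@[simp]
theorem mem_commonNbr {ι : Type*} {g : ι → W} {w : W} :
    w ∈ H.commonNbr g ↔ ∀ i, H.Adj (g i) w := by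
  classical simp [commonNbr]

theorem card_commonNbr_le {ι : Type*} [Nonempty ι] (g : ι → W) :
    (H.commonNbr g).card ≤ H.maxDeg := by
  obtain ⟨i⟩ := ‹Nonempty ι›
  exact (Finset.card_le_card fun w hw => mem_nbr.2 (mem_commonNbr.1 hw i)).trans
    (card_nbr_le (g i))

/-- Once one class of a complete bipartite graph is coloured, the vertices of the other class are
coloured independently. -/
theorem homCount_completeBipartiteGraph (α β : Type*) [Fintype α] [DecidableEq α] [Fintype β] :
    homCount (completeBipartiteGraph α β) H =
      ∑ g : α → W, (H.commonNbr g).card ^ Fintype.card β := by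
  classical
  let e : Colouring (completeBipartiteGraph α β) H ≃
      Σ g : α → W, (β → {w // w ∈ H.commonNbr g}) :=
    { toFun := fun f => ⟨fun i => f.1 (Sum.inl i), fun j => ⟨f.1 (Sum.inr j),
        mem_commonNbr.2 fun i => f.2 _ _ (by simp)⟩⟩
      invFun := fun p => ⟨Sum.elim p.1 fun j => (p.2 j).1, by
        rintro (i | j) (i' | j') h
        · simp at h
        · exact mem_commonNbr.1 (p.2 j').2 i
        · exact H.symm _ _ (mem_commonNbr.1 (p.2 j).2 i')
        · simp at h⟩
      left_inv := fun f => Subtype.ext (by ext (i | j) <;> rfl)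
      right_inv := fun p => rfl }
  rw [homCount, Nat.card_congr e, Nat.card_eq_fintype_card, Fintype.card_sigma]
  simp [-mem_commonNbr]

/-- The colours of an `α`-class that leave the maximal number `maxDeg` of colours for each vertex of
the other class. -/
noncomputable def goodTuples (H : LoopGraph W) (α : Type*) [Fintype α] [DecidableEq α] :
    Finset (α → W) :=
  Finset.univ.filter fun g => (H.commonNbr g).card = H.maxDeg

theorem card_goodTuples_mul_le (α β : Type*) [Fintype α] [DecidableEq α] [Fintype β] :
    (H.goodTuples α).card * H.maxDeg ^ Fintype.card β ≤
      homCount (completeBipartiteGraph α β) H := by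
  rw [homCount_completeBipartiteGraph, ← smul_eq_mul, ← Finset.sum_const]
  calc _ = ∑ g ∈ H.goodTuples α, (H.commonNbr g).card ^ Fintype.card β :=
        Finset.sum_congr rfl fun g hg => by rw [(Finset.mem_filter.1 hg).2]
    _ ≤ _ := Finset.sum_le_sum_of_subset (Finset.subset_univ _)

theorem card_goodTuples_pos [Nonempty W] (α : Type*) [Fintype α] [DecidableEq α] [Nonempty α] :
    0 < (H.goodTuples α).card := by
  obtain ⟨x, hx⟩ := exists_card_nbr_eq (H := H)
  refine Finset.card_pos.2 ⟨fun _ => x, Finset.mem_filter.2 ⟨Finset.mem_univ _, ?_⟩⟩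
  rw [← hx]
  congr 1
  ext w
  simp

variable {V : Type*} [Fintype V] [DecidableEq V] {G : SimpleGraph V}

/-- A tuple of colours on `A`, extended by a constant to a map on `V`. -/
def extendTuple {A : Finset V} (w₀ : W) (g : {x // x ∈ A} → W) (v : V) : W :=
  if h : v ∈ A then g ⟨v, h⟩ else w₀

theorem homCount_le_sum_extensions (A : Finset V) (w₀ : W) :
    homCount G H ≤ ∑ g : {x // x ∈ A} → W, (extensions G H A Aᶜ (extendTuple w₀ g)).card := by
  classical
  rw [homCount, Colouring, Nat.card_eq_fintype_card, Fintype.card_subtype,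
    Finset.card_eq_sum_card_fiberwise (f := fun f (x : {x // x ∈ A}) => f x.1)
      (t := Finset.univ) (by simp)]
  refine Finset.sum_le_sum fun g _ => Finset.card_le_card fun f hf => ?_
  simp only [Finset.mem_filter, Finset.mem_univ, true_and] at hf
  obtain ⟨hf, rfl⟩ := hf
  refine mem_extensions.2 ⟨fun v hv => ?_, fun u _ v _ => hf u v⟩
  have hvA : v ∈ A := by simpa using hv
  simp [extendTuple, hvA]

/-- Colouring a connected graph vertex by vertex. -/
theorem homCount_le_card_mul_pow (hG : G.Connected) :
    homCount G H ≤ Fintype.card W * H.maxDeg ^ (Fintype.card V - 1) := by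
  classical
  obtain ⟨v₀⟩ := hG.nonempty
  by_cases hW : Nonempty W
  · obtain ⟨w₀⟩ := hW
    refine (homCount_le_sum_extensions {v₀} w₀).trans ?_
    have key : ∀ g : V → W, (extensions G H {v₀} {v₀}ᶜ g).card ≤
        H.maxDeg ^ (Fintype.card V - 1) := by
      intro g
      have h := ((Build.nil (G := G) (A := {v₀}) (S₀ := ∅)).complete hG (by simp)
        (by simp)).card_extensions_le (H := H) g
      rw [Finset.card_compl, Finset.card_singleton, Finset.card_empty, pow_zero, mul_one] at h
      exact h.trans ((Nat.mul_le_mul_right _ card_extensions_empty_le).trans (one_mul _).le)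
    refine (Finset.sum_le_card_nsmul _ _ _ fun g _ => key _).trans ?_
    simp
  · have : IsEmpty (Colouring G H) := ⟨fun f => hW ⟨f.1 v₀⟩⟩
    simp [homCount]

/-- If `C` ears can be gained, where `C` is large, there are few colourings. -/
theorem homCount_lt_of_build (hH : H.Connected) (he : H.HasEdge) (h₁ : ¬ H.IsCompleteLooped)
    (h₂ : ¬ H.IsCompleteBalancedBipartite) (hG : G.Connected) {δ C : ℕ} (hδ : 1 ≤ δ)
    (hδV : δ ≤ Fintype.card V)
    (hC : Fintype.card W * H.maxDeg ^ (δ - 1) * (H.maxDeg ^ 2 - 1) ^ C < (H.maxDeg ^ 2) ^ C)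
    {v₀ : V} {S : Finset V} (hS : Build G {v₀} ∅ S C) :
    homCount G H < H.maxDeg ^ (Fintype.card V - δ) := by
  obtain ⟨w₀⟩ := hH.1
  have hD := he.maxDeg_pos
  have key : ∀ g : V → W, (extensions G H {v₀} {v₀}ᶜ g).card * (H.maxDeg ^ 2) ^ C ≤
      H.maxDeg ^ (Fintype.card V - 1) * (H.maxDeg ^ 2 - 1) ^ C := by
    intro g
    have h := (hS.complete hG (by simp) (by simp)).card_extensions_mul_le hH he h₁ h₂ g
    rwa [Finset.card_compl, Finset.card_singleton] at h
  refine Nat.lt_of_mul_lt_mul_right (a := (H.maxDeg ^ 2) ^ C) ?_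
  have hpow : H.maxDeg ^ (Fintype.card V - 1) =
      H.maxDeg ^ (Fintype.card V - δ) * H.maxDeg ^ (δ - 1) := by
    rw [← pow_add]; congr 1; omega
  calc homCount G H * (H.maxDeg ^ 2) ^ C
      ≤ (∑ g : {x // x ∈ ({v₀} : Finset V)} → W,
          (extensions G H {v₀} {v₀}ᶜ (extendTuple w₀ g)).card) * (H.maxDeg ^ 2) ^ C :=
        Nat.mul_le_mul_right _ (homCount_le_sum_extensions _ w₀)
    _ = ∑ g : {x // x ∈ ({v₀} : Finset V)} → W,
          (extensions G H {v₀} {v₀}ᶜ (extendTuple w₀ g)).card * (H.maxDeg ^ 2) ^ C :=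
        Finset.sum_mul _ _ _
    _ ≤ Fintype.card W * (H.maxDeg ^ (Fintype.card V - 1) * (H.maxDeg ^ 2 - 1) ^ C) := by
        refine (Finset.sum_le_card_nsmul _ _ _ fun g _ => key _).trans ?_
        simp
    _ = H.maxDeg ^ (Fintype.card V - δ) *
          (Fintype.card W * H.maxDeg ^ (δ - 1) * (H.maxDeg ^ 2 - 1) ^ C) := by
        rw [hpow]; ring
    _ < _ := Nat.mul_lt_mul_of_pos_left hC (pow_pos hD _)

/-- If the vertices of `A` have many common neighbours, then only good tuples on `A` contribute
substantially, and a single ear over `A` already pushes the number of colourings below that of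
the complete bipartite graph. -/
theorem homCount_lt_of_common_nbrs (hH : H.Connected) (he : H.HasEdge)
    (h₁ : ¬ H.IsCompleteLooped) (h₂ : ¬ H.IsCompleteBalancedBipartite) (hG : G.Connected)
    {A N S : Finset V} (hA : A.Nonempty) (hN : ∀ x ∈ N, ∀ a ∈ A, G.Adj a x)
    (hNc : Fintype.card W ^ A.card * (H.maxDeg - 1) ^ N.card * H.maxDeg ^ 2 < H.maxDeg ^ N.card)
    (hS : Build G A ∅ S 1) :
    homCount G H < (H.goodTuples {x // x ∈ A}).card * H.maxDeg ^ Aᶜ.card := by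
  classical
  obtain ⟨w₀⟩ := hH.1
  have hD := he.maxDeg_pos
  have : Nonempty {x // x ∈ A} := hA.to_subtype
  have hNA : Disjoint N A := Finset.disjoint_left.2 fun x hx hxA => (hN x hx x hxA).ne rfl
  have : Nonempty W := hH.1
  have hs := card_goodTuples_pos (H := H) {x // x ∈ A}
  have hgood : ∀ g : V → W, (extensions G H A Aᶜ g).card * H.maxDeg ^ 2 ≤
      H.maxDeg ^ Aᶜ.card * (H.maxDeg ^ 2 - 1) := by
    intro g
    simpa using (hS.complete hG hA (by simp)).card_extensions_mul_le hH he h₁ h₂ g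
  have hbad : ∀ g : {x // x ∈ A} → W, g ∉ H.goodTuples {x // x ∈ A} →
      (extensions G H A Aᶜ (extendTuple w₀ g)).card * H.maxDeg ^ N.card ≤
        (H.maxDeg - 1) ^ N.card * H.maxDeg ^ Aᶜ.card := by
    intro g hg
    have hlt : (H.commonNbr g).card ≤ H.maxDeg - 1 := by
      have h1 := card_commonNbr_le (H := H) g
      have h2 : (H.commonNbr g).card ≠ H.maxDeg := fun h => hg (by simp [goodTuples, h])
      omega
    refine (((Build.nil (G := G) (A := A) (S₀ := N)).complete hG hA
      hNA.symm).card_extensions_le _).trans (Nat.mul_le_mul_right _ ?_)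
    refine card_extensions_common_nbr_le hlt (fun w hw => mem_commonNbr.2 fun i => ?_) hNA hN
    have := hw i.1 i.2
    rwa [extendTuple, dif_pos i.2] at this
  set D := H.maxDeg
  set s := (H.goodTuples {x // x ∈ A}).card with hsdef
  have hsumgood : (∑ g ∈ H.goodTuples {x // x ∈ A},
      (extensions G H A Aᶜ (extendTuple w₀ g)).card) * D ^ 2 ≤
        s * (D ^ Aᶜ.card * (D ^ 2 - 1)) := by
    rw [Finset.sum_mul]
    simpa using Finset.sum_le_card_nsmul (H.goodTuples {x // x ∈ A}) _ _ fun g _ =>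
      hgood (extendTuple w₀ g)
  have hsumbad : (∑ g ∈ (H.goodTuples {x // x ∈ A})ᶜ,
      (extensions G H A Aᶜ (extendTuple w₀ g)).card) * D ^ N.card ≤
        Fintype.card W ^ A.card * ((D - 1) ^ N.card * D ^ Aᶜ.card) := by
    rw [Finset.sum_mul]
    refine (Finset.sum_le_card_nsmul _ _ _ fun g hg => hbad g (Finset.mem_compl.1 hg)).trans ?_
    rw [smul_eq_mul]
    refine Nat.mul_le_mul_right _ ((Finset.card_le_univ _).trans ?_)
    simp
  have hsplit := (homCount_le_sum_extensions (G := G) (H := H) A w₀).trans_eq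
    (Finset.sum_add_sum_compl (H.goodTuples {x // x ∈ A}) _).symm
  set a := ∑ g ∈ H.goodTuples {x // x ∈ A}, (extensions G H A Aᶜ (extendTuple w₀ g)).card
  set b := ∑ g ∈ (H.goodTuples {x // x ∈ A})ᶜ, (extensions G H A Aᶜ (extendTuple w₀ g)).card
  have hX : 0 < D ^ Aᶜ.card := pow_pos hD _
  have hD2 : D ^ 2 - 1 + 1 = D ^ 2 := Nat.sub_add_cancel (Nat.one_le_pow _ _ hD)
  refine Nat.lt_of_mul_lt_mul_right (a := D ^ 2 * D ^ N.card) ?_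
  calc homCount G H * (D ^ 2 * D ^ N.card) ≤ (a + b) * (D ^ 2 * D ^ N.card) :=
        Nat.mul_le_mul_right _ hsplit
    _ = a * D ^ 2 * D ^ N.card + b * D ^ N.card * D ^ 2 := by ring
    _ ≤ s * (D ^ Aᶜ.card * (D ^ 2 - 1)) * D ^ N.card +
        Fintype.card W ^ A.card * ((D - 1) ^ N.card * D ^ Aᶜ.card) * D ^ 2 :=
        Nat.add_le_add (Nat.mul_le_mul_right _ hsumgood) (Nat.mul_le_mul_right _ hsumbad)
    _ = s * (D ^ Aᶜ.card * (D ^ 2 - 1)) * D ^ N.card +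
        D ^ Aᶜ.card * (Fintype.card W ^ A.card * (D - 1) ^ N.card * D ^ 2) := by ring
    _ < s * (D ^ Aᶜ.card * (D ^ 2 - 1)) * D ^ N.card + D ^ Aᶜ.card * D ^ N.card :=
        Nat.add_lt_add_left (Nat.mul_lt_mul_of_pos_left hNc hX) _
    _ ≤ s * (D ^ Aᶜ.card * (D ^ 2 - 1)) * D ^ N.card + s * (D ^ Aᶜ.card * D ^ N.card) :=
        Nat.add_le_add_left (Nat.le_mul_of_pos_left _ hs) _
    _ = s * D ^ Aᶜ.card * ((D ^ 2 - 1 + 1) * D ^ N.card) := by ring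
    _ = _ := by rw [hD2]

end Count

end LoopGraph

/-! ### The dichotomy for large graphs and the extremal graph -/

namespace LoopGraph

theorem exists_mul_pow_lt_pow (k : ℕ) {a b : ℕ} (hab : a < b) : ∃ C : ℕ, k * a ^ C < b ^ C := by
  have hb : (0 : ℝ) < b := by exact_mod_cast (Nat.zero_le a).trans_lt hab
  have hlt : (a : ℝ) / b < 1 := (div_lt_one hb).2 (by exact_mod_cast hab)
  obtain ⟨C, hC⟩ := exists_pow_lt_of_lt_one (show (0 : ℝ) < 1 / (k + 1) by positivity) hlt
  refine ⟨C, ?_⟩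
  rw [div_pow, div_lt_div_iff₀ (pow_pos hb C) (by positivity), one_mul] at hC
  have h : (k : ℝ) * a ^ C < b ^ C := by
    have : (0 : ℝ) ≤ (a : ℝ) ^ C := by positivity
    linarith
  exact_mod_cast h

/-- Powers of logarithmic quantities are eventually smaller than `n`. -/
theorem exists_log_pow_lt (δ K G₀ : ℕ) (hδ : 1 ≤ δ) : ∃ κ : ℕ, ∀ n, κ ≤ n →
    (K * (2 * Nat.log 2 n + 6) + 1) ^ δ * G₀ + (K * (2 * Nat.log 2 n + 6) + 1) < n := by
  have ht := tendsto_pow_const_div_const_pow_of_one_lt δ (r := (2 : ℝ)) (by norm_num)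
  set M : ℕ := (8 * K + 1) ^ δ * (G₀ + 1) with hM
  have hMpos : 0 < M := by positivity
  obtain ⟨L₀, hL₀⟩ := Filter.eventually_atTop.1
    (ht.eventually (gt_mem_nhds (show (0 : ℝ) < 1 / (2 * M) by positivity)))
  refine ⟨2 ^ L₀, fun n hn => ?_⟩
  have hn0 : n ≠ 0 := (Nat.pos_of_ne_zero (by positivity)).trans_le hn |>.ne'
  set L := Nat.log 2 n
  have hL : L₀ ≤ L := Nat.le_log_of_pow_le one_lt_two hn
  have hLn : 2 ^ L ≤ n := Nat.pow_log_le_self 2 hn0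
  have h1 := hL₀ (L + 1) (by omega)
  rw [div_lt_div_iff₀ (by positivity) (by positivity), one_mul, pow_succ (2 : ℝ)] at h1
  have h2 : M * (L + 1) ^ δ < 2 ^ L := by
    have : ((M * (L + 1) ^ δ : ℕ) : ℝ) < ((2 ^ L : ℕ) : ℝ) := by
      push_cast at h1 ⊢
      linarith
    exact_mod_cast this
  have h3 : K * (2 * L + 6) + 1 ≤ (8 * K + 1) * (L + 1) := by nlinarith [Nat.zero_le (K * L)]
  calc (K * (2 * L + 6) + 1) ^ δ * G₀ + (K * (2 * L + 6) + 1)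
      ≤ (K * (2 * L + 6) + 1) ^ δ * G₀ + (K * (2 * L + 6) + 1) ^ δ :=
        Nat.add_le_add_left (Nat.le_self_pow (by omega) _) _
    _ = (K * (2 * L + 6) + 1) ^ δ * (G₀ + 1) := by ring
    _ ≤ ((8 * K + 1) * (L + 1)) ^ δ * (G₀ + 1) :=
        Nat.mul_le_mul_right _ (Nat.pow_le_pow_left h3 δ)
    _ = M * (L + 1) ^ δ := by rw [hM, mul_pow]; ring
    _ < 2 ^ L := h2
    _ ≤ n := hLn

/-- If a small set `S` meets every edge, then by the pigeonhole principle some `δ` vertices have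
many common neighbours. -/
theorem exists_common_nbrs {V : Type*} [Fintype V] [DecidableEq V] {G : SimpleGraph V}
    [DecidableRel G.Adj] {δ G₀ : ℕ} (hdeg : ∀ v, δ ≤ G.degree v) {S : Finset V} {t : ℕ}
    (hS : ∀ x x', G.Adj x x' → x ∈ S ∨ x' ∈ S) (hSt : S.card ≤ t)
    (ht : t ^ δ * G₀ + t < Fintype.card V) :
    ∃ A N : Finset V, A.card = δ ∧ N.card = G₀ ∧ ∀ x ∈ N, ∀ a ∈ A, G.Adj a x := by
  have hch : ∀ v, ∃ B ⊆ G.neighborFinset v, B.card = δ := fun v =>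
    Finset.exists_subset_card_eq ((hdeg v).trans_eq (G.card_neighborFinset_eq_degree v).symm)
  choose B hBsub hBc using hch
  have hmaps : ∀ v ∈ Sᶜ, B v ∈ S.powersetCard δ := fun v hv =>
    Finset.mem_powersetCard.2 ⟨fun w hw =>
      (hS v w ((G.mem_neighborFinset v w).1 (hBsub v hw))).resolve_left (Finset.mem_compl.1 hv),
      hBc v⟩
  have hcard : (S.powersetCard δ).card * G₀ < Sᶜ.card := by
    rw [Finset.card_powersetCard, Finset.card_compl]
    have h1 : S.card.choose δ ≤ t ^ δ :=
      (Nat.choose_le_pow _ _).trans (Nat.pow_le_pow_left hSt δ)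
    have := Nat.mul_le_mul_right G₀ h1
    omega
  obtain ⟨A, hA, hlt⟩ := Finset.exists_lt_card_fiber_of_mul_lt_card_of_maps_to hmaps hcard
  obtain ⟨N, hN, hNc⟩ := Finset.exists_subset_card_eq hlt.le
  refine ⟨A, N, (Finset.mem_powersetCard.1 hA).2, hNc, fun x hx a ha => ?_⟩
  obtain ⟨-, rfl⟩ := Finset.mem_filter.1 (hN hx)
  exact ((G.mem_neighborFinset x a).1 (hBsub x ha)).symm

/-- For large `n`, either `G` has fewer colourings than `K_{δ,n-δ}`, or `G` consists of `K_{δ,n-δ}`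
and possibly some edges inside the class of size `δ`. -/
theorem homCount_lt_or_exists_class (δ : ℕ) (hδ : 3 ≤ δ) {W : Type*} [Fintype W]
    {H : LoopGraph W} (hH : H.Connected) (he : H.HasEdge) (h₁ : ¬ H.IsCompleteLooped)
    (h₂ : ¬ H.IsCompleteBalancedBipartite) :
    ∃ κ : ℕ, ∀ {V : Type*} [Fintype V] [DecidableEq V] (G : SimpleGraph V) [DecidableRel G.Adj],
      κ ≤ Fintype.card V → G.Connected → (∀ v, δ ≤ G.degree v) →
        homCount G H < homCount (completeBipartiteGraph (Fin δ) (Fin (Fintype.card V - δ))) H ∨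
        ∃ A : Finset V, A.card = δ ∧ (∀ x ∉ A, ∀ a ∈ A, G.Adj a x) ∧
          ∀ x ∉ A, ∀ y ∉ A, ¬ G.Adj x y := by
  have hD := he.maxDeg_pos
  have : Nonempty W := hH.1
  obtain ⟨C, hC⟩ := exists_mul_pow_lt_pow (Fintype.card W * H.maxDeg ^ (δ - 1))
    (show H.maxDeg ^ 2 - 1 < H.maxDeg ^ 2 from Nat.sub_lt (pow_pos hD 2) one_pos)
  obtain ⟨G₀, hG₀⟩ := exists_mul_pow_lt_pow (Fintype.card W ^ δ * H.maxDeg ^ 2)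
    (show H.maxDeg - 1 < H.maxDeg from Nat.sub_lt hD one_pos)
  obtain ⟨κ, hκ⟩ := exists_log_pow_lt δ C G₀ (by omega)
  refine ⟨κ, fun {V} _ _ G _ hV hG hdeg => ?_⟩
  obtain ⟨v₀⟩ := hG.nonempty
  have hδV : δ ≤ Fintype.card V := (hdeg v₀).trans (G.degree_lt_card_verts v₀).le
  have : Nonempty (Fin δ) := ⟨⟨0, by omega⟩⟩
  rcases exists_build_or_cover (A := {v₀}) hG (by simp) (fun v => hδ.trans (hdeg v)) C with
    ⟨S, hS, -⟩ | ⟨S, hSc, hS⟩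
  · left
    refine (homCount_lt_of_build hH he h₁ h₂ hG (by omega) hδV hC hS).trans_le ?_
    refine le_trans ?_ (card_goodTuples_mul_le (H := H) (Fin δ) (Fin (Fintype.card V - δ)))
    rw [Fintype.card_fin]
    exact Nat.le_mul_of_pos_left _ (card_goodTuples_pos _)
  · obtain ⟨A, N, hA, hN, hAN⟩ := exists_common_nbrs hdeg hS
      (t := C * (2 * Nat.log 2 (Fintype.card V) + 6) + 1)
      ((Finset.card_union_le _ _).trans (by rw [Finset.card_singleton]; omega)) (hκ _ hV)
    have hne : A.Nonempty := Finset.card_pos.1 (by omega)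
    by_cases hind : ∀ x ∉ A, ∀ y ∉ A, ¬ G.Adj x y
    · right
      refine ⟨A, hA, fun x hx a ha => ?_, hind⟩
      have hsub : G.neighborFinset x ⊆ A := by
        intro y hy
        by_contra hyA
        exact hind x hx y hyA ((G.mem_neighborFinset x y).1 hy)
      have heq := Finset.eq_of_subset_of_card_le hsub
        (by rw [hA, G.card_neighborFinset_eq_degree]; exact hdeg x)
      rw [← heq] at ha
      exact ((G.mem_neighborFinset x a).1 ha).symm
    · left
      push Not at hind
      obtain ⟨x, hx, y, hy, hxy⟩ := hind
      obtain ⟨S', hS'⟩ := (Build.nil (G := G) (A := A) (S₀ := ∅)).exists_ear_of_adj hG hne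
        (fun v => le_trans (by omega) (hdeg v)) (by simpa using hx) (by simpa using hy) hxy
      refine (homCount_lt_of_common_nbrs hH he h₁ h₂ hG hne hAN ?_ hS').trans_le ?_
      · rw [hA, hN]
        calc _ = Fintype.card W ^ δ * H.maxDeg ^ 2 * (H.maxDeg - 1) ^ G₀ := by ring
          _ < _ := hG₀
      · have h := card_goodTuples_mul_le (H := H) {x // x ∈ A} (Fin (Fintype.card V - δ))
        rw [Fintype.card_fin] at h
        rw [Finset.card_compl, hA]
        exact h.trans_eq (homCount_congr
          (completeBipartiteIso (Fintype.equivFinOfCardEq (by simpa using hA)) (Equiv.refl _)))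

/-- If `G` contains the complete bipartite graph on `A` and its independent complement, then `G` has
at most as many colourings, and strictly fewer if `A` spans an edge. -/
theorem homCount_le_and_iso_of_class {W : Type*} [Finite W] {H : LoopGraph W} {V : Type*}
    [Fintype V] [DecidableEq V] {G : SimpleGraph V} {A : Finset V} {δ : ℕ} (hA : A.card = δ)
    (hAG : ∀ x ∉ A, ∀ a ∈ A, G.Adj a x) (hind : ∀ x ∉ A, ∀ y ∉ A, ¬ G.Adj x y) :
    homCount G H ≤ homCount (completeBipartiteGraph (Fin δ) (Fin (Fintype.card V - δ))) H ∧
      (H.Connected → H.HasEdge → ¬ H.IsCompleteLooped →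
        homCount G H = homCount (completeBipartiteGraph (Fin δ) (Fin (Fintype.card V - δ))) H →
        Nonempty (G ≃g completeBipartiteGraph (Fin δ) (Fin (Fintype.card V - δ)))) := by
  let iso : completeBipartiteGraph {x // x ∈ A} {x // x ∉ A} ≃g
      completeBipartiteGraph (Fin δ) (Fin (Fintype.card V - δ)) :=
    completeBipartiteIso (Fintype.equivFinOfCardEq (by simpa using hA))
      (Fintype.equivFinOfCardEq (by rw [Fintype.card_subtype_compl]; simp [hA]))
  rw [← homCount_congr iso]
  let e : {x // x ∈ A} ⊕ {x // x ∉ A} ≃ V := Equiv.sumCompl (· ∈ A)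
  have hKG : ∀ p q, (completeBipartiteGraph {x // x ∈ A} {x // x ∉ A}).Adj p q →
      G.Adj (e p) (e q) := by
    rintro (p | p) (q | q) h
    · simp at h
    · exact hAG _ q.2 _ p.2
    · exact (hAG _ p.2 _ q.2).symm
    · simp at h
  let Φ : Colouring G H → Colouring (completeBipartiteGraph {x // x ∈ A} {x // x ∉ A}) H :=
    fun f => ⟨f.1 ∘ e, fun p q h => f.2 _ _ (hKG p q h)⟩
  have hΦ : Function.Injective Φ := by
    intro f f' h
    refine Subtype.ext (funext fun v => ?_)
    have := congrFun (congrArg Subtype.val h) (e.symm v)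
    simpa [Φ] using this
  have hfin : Finite (Colouring (completeBipartiteGraph {x // x ∈ A} {x // x ∉ A}) H) :=
    inferInstanceAs (Finite {f : {x // x ∈ A} ⊕ {x // x ∉ A} → W // _})
  refine ⟨Nat.card_le_card_of_injective Φ hΦ, fun hH he h₁ heq => ?_⟩
  have hsurj : Function.Surjective Φ :=
    ((Nat.bijective_iff_injective_and_card Φ).2 ⟨hΦ, heq⟩).2
  suffices hGK : ∀ p q, G.Adj (e p) (e q) →
      (completeBipartiteGraph {x // x ∈ A} {x // x ∉ A}).Adj p q from
    ⟨(RelIso.symm ⟨e, fun {p q} => ⟨hGK p q, hKG p q⟩⟩).trans iso⟩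
  intro p q h
  rcases p with p | p <;> rcases q with q | q
  · exfalso
    -- Colours `x` and `y` with a common neighbour `z` that are not adjacent themselves.
    obtain ⟨x, y, z, hxz, hyz, hxy⟩ := hH.exists_common_nbr_not_adj he h₁
    obtain ⟨f, hf⟩ := hsurj ⟨Sum.elim (fun i => if i = p then x else y) fun _ => z, by
      rintro (i | i) (j | j) hij
      · simp at hij
      · simp only [Sum.elim_inl, Sum.elim_inr]; split_ifs <;> assumption
      · simp only [Sum.elim_inl, Sum.elim_inr]
        split_ifs
        exacts [H.symm _ _ hxz, H.symm _ _ hyz]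
      · simp at hij⟩
    have hval : ∀ s, f.1 (e s) = _ := fun s => congrFun (congrArg Subtype.val hf) s
    have hpq : q ≠ p := fun h' => h.ne (by rw [h'])
    have hadj := f.2 _ _ h
    rw [hval, hval] at hadj
    simp [hpq] at hadj
    exact hxy hadj
  · simp
  · simp
  · exact absurd h (hind _ p.2 _ q.2)

/-- For a complete looped graph every map is a colouring. -/
theorem homCount_le_of_isCompleteLooped {W V : Type*} [Finite W] [Fintype V] {H : LoopGraph W}
    (h : H.IsCompleteLooped) {G : SimpleGraph V} {δ : ℕ} (hδ : δ ≤ Fintype.card V) :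
    homCount G H ≤ homCount (completeBipartiteGraph (Fin δ) (Fin (Fintype.card V - δ))) H := by
  -- The two graphs have vertex types in different universes, so the count is stated for each.
  have key : ∀ {U : Type _} (G : SimpleGraph U), homCount G H = Nat.card (U → W) := fun G =>
    Nat.card_congr (Equiv.subtypeUnivEquiv fun f u v _ => h _ _)
  have key' : ∀ {U : Type} (G : SimpleGraph U), homCount G H = Nat.card (U → W) := fun G =>
    Nat.card_congr (Equiv.subtypeUnivEquiv fun f u v _ => h _ _)
  rw [key, key']
  refine (Nat.card_congr (Equiv.arrowCongr (Fintype.equivOfCardEq ?_) (Equiv.refl W))).le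
  simp [hδ]

/-- A connected graph on `n` vertices has at most `2 * k ^ n` colourings by `K_{k,k}`, and a complete
bipartite graph attains this: choose which class goes to which side, then all colours freely. -/
theorem homCount_le_of_isCompleteBalancedBipartite {W V : Type*} [Fintype W] [Fintype V]
    {H : LoopGraph W} (h : H.IsCompleteBalancedBipartite) {G : SimpleGraph V} (hG : G.Connected)
    {δ : ℕ} (hδ : 1 ≤ δ) (hδV : δ ≤ Fintype.card V) :
    homCount G H ≤ homCount (completeBipartiteGraph (Fin δ) (Fin (Fintype.card V - δ))) H := by
  classical
  obtain ⟨k, e, he⟩ := h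
  have hdeg : H.maxDeg ≤ k := by
    refine Finset.sup_le fun x _ => ?_
    have : (H.nbr x).card ≤ (Finset.univ : Finset (Fin k)).card := by
      refine Finset.card_le_card_of_injOn (fun y => Sum.elim id id (e y)) (by simp) ?_
      intro y hy z hz hyz
      rw [Finset.mem_coe, mem_nbr, he] at hy hz
      apply e.injective
      rcases hx : e x with i | i <;> rcases hy' : e y with j | j <;> rcases hz' : e z with l | l <;>
        simp_all
    simpa using this
  have hW : Fintype.card W = 2 * k := by
    rw [Fintype.card_congr e]; simp [two_mul]
  have hlow : 2 * k ^ Fintype.card V ≤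
      homCount (completeBipartiteGraph (Fin δ) (Fin (Fintype.card V - δ))) H := by
    let Ψ : Bool × (Fin δ ⊕ Fin (Fintype.card V - δ) → Fin k) →
        Colouring (completeBipartiteGraph (Fin δ) (Fin (Fintype.card V - δ))) H := fun p =>
      ⟨fun s => e.symm (if p.1 = s.isLeft then Sum.inl (p.2 s) else Sum.inr (p.2 s)), by
        obtain ⟨b, φ⟩ := p
        rintro (i | i) (j | j) hij <;> rw [he] <;> cases b <;> simp_all⟩
    have hΨ : Function.Injective Ψ := by
      rintro ⟨b, φ⟩ ⟨b', φ'⟩ h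
      have hval : ∀ s, (if b = s.isLeft then Sum.inl (φ s) else Sum.inr (φ s) : Fin k ⊕ Fin k) =
          if b' = s.isLeft then Sum.inl (φ' s) else Sum.inr (φ' s) := fun s =>
        e.symm.injective (congrFun (congrArg Subtype.val h) s)
      have hb : b = b' := by
        have := hval (Sum.inl ⟨0, hδ⟩)
        cases b <;> cases b' <;> simp_all
      subst hb
      refine Prod.ext rfl (funext fun s => ?_)
      have := hval s
      split_ifs at this
      exacts [Sum.inl.inj this, Sum.inr.inj this]
    have hfin : Finite (Colouring (completeBipartiteGraph (Fin δ) (Fin (Fintype.card V - δ))) H) :=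
      inferInstanceAs (Finite {f : Fin δ ⊕ Fin (Fintype.card V - δ) → W // _})
    have := Nat.card_le_card_of_injective Ψ hΨ
    simpa [homCount, hδV] using this
  have hpos : 0 < Fintype.card V := by omega
  calc homCount G H ≤ Fintype.card W * H.maxDeg ^ (Fintype.card V - 1) :=
        homCount_le_card_mul_pow hG
    _ ≤ 2 * k * k ^ (Fintype.card V - 1) := by
        rw [hW]; exact Nat.mul_le_mul_left _ (Nat.pow_le_pow_left hdeg _)
    _ = 2 * k ^ (Fintype.card V - 1 + 1) := by ring
    _ = 2 * k ^ Fintype.card V := by rw [Nat.sub_add_cancel hpos]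
    _ ≤ _ := hlow

end LoopGraph

theorem theorem1p1 (δ : ℕ) (hδ : 3 ≤ δ) {W : Type*} [Finite W] (H : LoopGraph W)
    (hH : H.Connected) :
    ∃ κ : ℕ, ∀ n : ℕ, κ ≤ n →
      ∀ {V : Type*} [Fintype V] (G : SimpleGraph V) [DecidableRel G.Adj],
        Fintype.card V = n → G.Connected → δ ≤ G.minDegree →
          LoopGraph.homCount G H ≤
              LoopGraph.homCount (completeBipartiteGraph (Fin δ) (Fin (n - δ))) H ∧
          (H.HasEdge → ¬ H.IsCompleteLooped → ¬ H.IsCompleteBalancedBipartite →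
            (LoopGraph.homCount G H =
                LoopGraph.homCount (completeBipartiteGraph (Fin δ) (Fin (n - δ))) H ↔
              Nonempty (G ≃g completeBipartiteGraph (Fin δ) (Fin (n - δ))))) := by
  classical
  have := Fintype.ofFinite W
  have hcard : ∀ {V : Type _} [Fintype V] (G : SimpleGraph V) [DecidableRel G.Adj],
      G.Connected → δ ≤ G.minDegree → δ ≤ Fintype.card V := by
    intro V _ G _ hG hdeg
    obtain ⟨v⟩ := hG.nonempty
    exact (hdeg.trans (G.minDegree_le_degree v)).trans (G.degree_lt_card_verts v).le
  by_cases he : H.HasEdge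
  · by_cases h₁ : H.IsCompleteLooped
    · refine ⟨0, fun n _ V _ G _ hn hG hdeg => ⟨?_, fun _ h => absurd h₁ h⟩⟩
      subst hn
      exact LoopGraph.homCount_le_of_isCompleteLooped h₁ (hcard G hG hdeg)
    by_cases h₂ : H.IsCompleteBalancedBipartite
    · refine ⟨0, fun n _ V _ G _ hn hG hdeg => ⟨?_, fun _ _ h => absurd h₂ h⟩⟩
      subst hn
      exact LoopGraph.homCount_le_of_isCompleteBalancedBipartite h₂ hG (by omega)
        (hcard G hG hdeg)
    obtain ⟨κ, hκ⟩ := LoopGraph.homCount_lt_or_exists_class δ hδ hH he h₁ h₂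
    refine ⟨κ, fun n hκn V _ G _ hn hG hdeg => ?_⟩
    subst hn
    rcases hκ G hκn hG fun v => hdeg.trans (G.minDegree_le_degree v) with hlt | ⟨A, hA, hAG, hind⟩
    · exact ⟨hlt.le, fun _ _ _ => ⟨fun h => absurd h hlt.ne, fun ⟨e⟩ => LoopGraph.homCount_congr e⟩⟩
    · obtain ⟨hle, heq⟩ := LoopGraph.homCount_le_and_iso_of_class (H := H) hA hAG hind
      exact ⟨hle, fun _ _ _ => ⟨heq hH he h₁, fun ⟨e⟩ => LoopGraph.homCount_congr e⟩⟩
  · refine ⟨0, fun n _ V _ G _ hn hG hdeg => ⟨?_, fun h => absurd h he⟩⟩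
    obtain ⟨v⟩ := hG.nonempty
    have hv : 0 < G.degree v := lt_of_lt_of_le (by omega) (hdeg.trans (G.minDegree_le_degree v))
    obtain ⟨w, hw⟩ := (G.degree_pos_iff_exists_adj v).1 hv
    exact (LoopGraph.homCount_eq_zero ⟨v, w, hw⟩ he).le.trans (Nat.zero_le _)
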